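/- Let $n\ge 1$ and let $a_1,\dots,a_n,b_1,\dots,b_n$ be real numbers with $0\le a_ib_j<1$ for all $i,j$. Let $x_{i,j}$ $(1\le i,j\le n)$ be independent random variables with the geometric distributions $$\Pr(x_{i,j}=k)=(1-a_ib_j)(a_ib_j)^k,\qquad k=0,1,2,\dots .$$ Let $L_n$ be the last passage time $$L_n=\max_{\pi}\sum_{(i,j)\in\pi}x_{i,j},$$ where the maximum is over all lattice paths $\pi$ from $(1,1)$ to $(n,n)$ each of whose steps goes one unit up or one unit to the right. Then for every integer $l\ge 0$ $$\Pr(L_n\le l)=\prod_{i,j=1}^n(1-a_ib_j)\,\Big\langle\prod_{j=1}^n\prod_{k=1}^l(1+a_je^{-i\theta_k})(1+b_je^{i\theta_k})\Big\rangle_{U(l)},$$ where $\langle F\rangle_{U(l)}$ is the average of $F$ over the eigenvalue angles of a uniformly distributed matrix in $U(l)$, that is, $$\langle F\rangle_{U(l)}=\frac{1}{(2\pi)^l\,l!}\int_{[0,2\pi]^l}F(\theta_1,\dots,\theta_l)\prod_{1\le j<k\le l}|e^{i\theta_k}-e^{i\theta_j}|^2\,d\theta_1\cdots d\theta_l .$$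 -/

import Mathlib

namespace JohanssonModel

/-- A single lattice step in the `n × n` square: one unit in the first coordinate or one unit in
the second coordinate (coordinates run over `0, …, n - 1` instead of `1, …, n`). -/
def Step {n : ℕ} (p q : Fin n × Fin n) : Prop :=
  ((p.1 : ℕ) + 1 = q.1 ∧ p.2 = q.2) ∨ (p.1 = q.1 ∧ (p.2 : ℕ) + 1 = q.2)

/-- The list of sites visited by an up / right-horizontal lattice path from the bottom left corner
to the top right corner of the `n × n` square. -/
def IsUpRightPath {n : ℕ} [NeZero n] (p : List (Fin n × Fin n)) : Prop :=
  p.head? = some (0, 0) ∧ p.getLast? = some (⊤, ⊤) ∧ p.IsChain Step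

/-- The set of all sums of the entries of `x` along up / right-horizontal paths. -/
def pathSums {n : ℕ} [NeZero n] (x : Fin n → Fin n → ℕ) : Set ℕ :=
  {s | ∃ p : List (Fin n × Fin n), IsUpRightPath p ∧ s = (p.map fun q => x q.1 q.2).sum}

/-- The last passage time: the maximum of the path sums
(a genuine maximum, see `isGreatest_lastPassageTime`). -/
noncomputable def lastPassageTime {n : ℕ} [NeZero n] (x : Fin n → Fin n → ℕ) : ℕ :=
  sSup (pathSums x)

theorem Step.lt {n : ℕ} {p q : Fin n × Fin n} (h : Step p q) : p < q := by
  rw [Prod.lt_iff]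
  rcases h with ⟨h1, h2⟩ | ⟨h1, h2⟩
  · left; exact ⟨by rw [Fin.lt_def]; omega, h2.le⟩
  · right; exact ⟨h1.le, by rw [Fin.lt_def]; omega⟩

theorem bddAbove_pathSums {n : ℕ} [NeZero n] (x : Fin n → Fin n → ℕ) :
    BddAbove (pathSums x) := by
  refine ⟨∑ q : Fin n × Fin n, x q.1 q.2, ?_⟩
  rintro s ⟨p, ⟨-, -, hp⟩, rfl⟩
  have hlt : p.IsChain (· < ·) := hp.imp fun _ _ h => h.lt
  have hnd : p.Nodup := (List.isChain_iff_pairwise.1 hlt).imp fun h => ne_of_lt h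
  rw [← List.sum_toFinset _ hnd]
  exact Finset.sum_le_sum_of_subset (Finset.subset_univ _)

theorem exists_path {n : ℕ} [NeZero n] : ∀ (m : ℕ) (q : Fin n × Fin n),
    (q.1 : ℕ) + q.2 = m →
    ∃ p : List (Fin n × Fin n), p.head? = some (0, 0) ∧ p.getLast? = some q ∧ p.IsChain Step := by
  intro m
  induction m with
  | zero =>
    intro q hq
    refine ⟨[(0, 0)], rfl, ?_, by simp⟩
    have : q = (0, 0) := by
      have h1 : (q.1 : ℕ) = 0 := by omega
      have h2 : (q.2 : ℕ) = 0 := by omega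
      ext
      · simpa using h1
      · simpa using h2
    simp [this]
  | succ m ih =>
    intro q hq
    have : ∃ r : Fin n × Fin n, (r.1 : ℕ) + r.2 = m ∧ Step r q := by
      by_cases h : (q.1 : ℕ) = 0
      · exact ⟨(q.1, ⟨q.2 - 1, by omega⟩), by simp; omega, Or.inr ⟨rfl, by simp; omega⟩⟩
      · exact ⟨(⟨q.1 - 1, by omega⟩, q.2), by simp; omega, Or.inl ⟨by simp; omega, rfl⟩⟩
    obtain ⟨r, hr, hs⟩ := this
    obtain ⟨p, h1, h2, h3⟩ := ih r hr
    refine ⟨p ++ [q], by simp [h1], by simp, ?_⟩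
    rw [List.isChain_append]
    refine ⟨h3, by simp, ?_⟩
    intro y hy z hz
    rw [h2] at hy
    simp at hy hz
    subst hy hz
    exact hs

theorem isGreatest_lastPassageTime {n : ℕ} [NeZero n] (x : Fin n → Fin n → ℕ) :
    IsGreatest (pathSums x) (lastPassageTime x) := by
  obtain ⟨p, hp⟩ := exists_path (n := n) _ (⊤, ⊤) rfl
  exact ⟨Nat.sSup_mem ⟨_, p, hp, rfl⟩ (bddAbove_pathSums x),
    fun s hs => le_csSup (bddAbove_pathSums x) hs⟩

/-- The eigenvalue probability density of a uniformly distributed matrix in `U(l)`, as a function of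
the eigenvalue angles `θ ∈ [0, 2π]^l`:
`(1 / ((2π)^l l!)) ∏_{j < k} |e^{iθ_k} - e^{iθ_j}|²`. -/
noncomputable def unitaryDensity (l : ℕ) (θ : Fin l → ℝ) : ℝ :=
  1 / ((2 * Real.pi) ^ l * (Nat.factorial l : ℝ)) *
    ∏ j : Fin l, ∏ k ∈ Finset.Ioi j,
      ‖Complex.exp (Complex.I * (θ k : ℂ)) - Complex.exp (Complex.I * (θ j : ℂ))‖ ^ 2

/-- The average `⟨F(θ_1, …, θ_l)⟩_{U(l)}` over the eigenvalue angles. -/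
noncomputable def unitaryAverage (l : ℕ) (F : (Fin l → ℝ) → ℂ) : ℂ :=
  ∫ θ in Set.Icc (0 : Fin l → ℝ) (fun _ => 2 * Real.pi), F θ * (unitaryDensity l θ : ℂ)

end JohanssonModel

/-!
Fomin's local rule turns a matrix `x` of natural numbers into a pair of chains of horizontal strips
ending at the same diagram: this is the Robinson-Schensted-Knuth correspondence. The first row of
the diagrams obeys the recursion of the last passage time, and the number of cells added along the
two chains records the row and column sums of `x`. So the sum of `∏ (a i * b j) ^ x i j` over the
matrices with last passage time at most `l` is the Cauchy sum `∑ s_μ(a) s_μ(b)` restricted to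
the diagrams `μ` with at most `l` columns.

On the unitary side, multiplication by `∏ k, (1 + b * z k)` raises some of the exponents of an
alternant by one, that is, adds a horizontal strip to its diagram. Starting from the Vandermonde
determinant, `n` such multiplications give a dual Cauchy identity. Integrated against the product
of the two Vandermonde determinants, the orthogonality of the alternants (Andréief's identity)
leaves the same sum `∑ s_μ(a) s_μ(b)`.
-/

namespace JohanssonModel

open YoungDiagram

/-! ### Horizontal strips -/

section YoungDiagrams

variable {μ ν : YoungDiagram}

theorem le_iff_rowLen : μ ≤ ν ↔ ∀ i, μ.rowLen i ≤ ν.rowLen i := by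
  constructor
  · intro h i
    by_contra! hlt
    exact (mem_iff_lt_rowLen.1 (h (mem_iff_lt_rowLen.2 hlt))).false
  · rintro h ⟨i, j⟩ hij
    exact mem_iff_lt_rowLen.2 ((mem_iff_lt_rowLen.1 hij).trans_le (h i))

theorem ext_rowLen (h : ∀ i, μ.rowLen i = ν.rowLen i) : μ = ν :=
  le_antisymm (le_iff_rowLen.2 fun i => (h i).le) (le_iff_rowLen.2 fun i => (h i).ge)

theorem ext_colLen (h : ∀ j, μ.colLen j = ν.colLen j) : μ = ν := by
  rw [← transpose_eq_iff]
  exact ext_rowLen fun i => by simpa only [rowLen_transpose] using h i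

theorem rowLen_eq_zero_iff {i : ℕ} : μ.rowLen i = 0 ↔ μ.colLen 0 ≤ i := by
  have := (mem_iff_lt_rowLen (μ := μ) (i := i) (j := 0)).symm.trans mem_iff_lt_colLen
  omega

theorem colLen_eq_zero_iff {j : ℕ} : μ.colLen j = 0 ↔ μ.rowLen 0 ≤ j := by
  have := (mem_iff_lt_rowLen (μ := μ) (i := 0) (j := j)).symm.trans mem_iff_lt_colLen
  omega

@[simp] theorem rowLen_bot (i : ℕ) : (⊥ : YoungDiagram).rowLen i = 0 := by
  by_contra h
  exact notMem_bot _ (mem_iff_lt_rowLen.2 (Nat.pos_of_ne_zero h))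

@[simp] theorem colLen_bot (j : ℕ) : (⊥ : YoungDiagram).colLen j = 0 := by
  by_contra h
  exact notMem_bot _ (mem_iff_lt_colLen.2 (Nat.pos_of_ne_zero h))

theorem card_eq_sum_rowLen {N : ℕ} (hN : μ.colLen 0 ≤ N) :
    μ.card = ∑ i ∈ Finset.range N, μ.rowLen i := by
  rw [YoungDiagram.card, Finset.card_eq_sum_card_fiberwise (f := Prod.fst) (t := Finset.range N)]
  · exact Finset.sum_congr rfl fun i _ => μ.rowLen_eq_card.symm
  · rintro ⟨i, j⟩ h
    have hi := mem_iff_lt_colLen.1 (μ.up_left_mem le_rfl (Nat.zero_le j) h)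
    simpa using hi.trans_le hN

@[simp] theorem card_transpose (μ : YoungDiagram) : μ.transpose.card = μ.card := by
  simp [YoungDiagram.card, transpose]

theorem card_eq_sum_colLen {N : ℕ} (hN : μ.rowLen 0 ≤ N) :
    μ.card = ∑ j ∈ Finset.range N, μ.colLen j := by
  rw [← card_transpose, card_eq_sum_rowLen (N := N) (by simpa only [colLen_transpose] using hN)]
  simp only [rowLen_transpose]

/-- The Young diagram with row lengths `f 0, …, f (N - 1)`, when these decrease
(in general, the largest Young diagram with at most `N` rows and at most these row lengths). -/
def ofRows (f : ℕ → ℕ) (N : ℕ) : YoungDiagram where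
  cells := {c ∈ Finset.range N ×ˢ Finset.range (f 0) | ∀ i ≤ c.1, c.2 < f i}
  isLowerSet := by
    rintro ⟨i, j⟩ ⟨i', j'⟩ ⟨hi, hj⟩ h
    simp only [Finset.coe_filter, Finset.mem_product, Finset.mem_range,
      Set.mem_ofPred_eq] at h hi hj ⊢
    exact ⟨⟨by omega, by omega⟩, fun k hk => hj.trans_lt (h.2 k (hk.trans hi))⟩

theorem rowLen_ofRows {f : ℕ → ℕ} {N : ℕ} (hf : Antitone f) (hN : f N = 0) (i : ℕ) :
    (ofRows f N).rowLen i = f i := by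
  refine eq_of_forall_lt_iff fun j => ?_
  rw [← mem_iff_lt_rowLen, ← mem_cells, ofRows, Finset.mem_filter, Finset.mem_product,
    Finset.mem_range, Finset.mem_range]
  refine ⟨fun h => h.2 i le_rfl, fun h => ⟨⟨?_, h.trans_le (hf i.zero_le)⟩,
    fun k hk => h.trans_le (hf hk)⟩⟩
  by_contra! hle
  exact (h.trans_le (hf hle)).not_ge (hN.trans_le j.zero_le)

theorem exists_colLen_eq {f : ℕ → ℕ} {N : ℕ} (hf : Antitone f) (hN : f N = 0) :
    ∃ μ : YoungDiagram, ∀ j, μ.colLen j = f j :=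
  ⟨(ofRows f N).transpose, fun j => by rw [colLen_transpose, rowLen_ofRows hf hN]⟩

/-- `IsHorizontalStrip μ ν` says that `μ ⊆ ν` and that the skew diagram `ν / μ` has at most one
cell in each column. -/
def IsHorizontalStrip (μ ν : YoungDiagram) : Prop :=
  μ ≤ ν ∧ ∀ i j, (i + 1, j) ∈ ν → (i, j) ∈ μ

theorem isHorizontalStrip_iff_rowLen :
    IsHorizontalStrip μ ν ↔ ∀ i, μ.rowLen i ≤ ν.rowLen i ∧ ν.rowLen (i + 1) ≤ μ.rowLen i := by
  rw [IsHorizontalStrip, le_iff_rowLen, forall_and]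
  refine and_congr Iff.rfl (forall_congr' fun i => ?_)
  simp only [mem_iff_lt_rowLen]
  exact forall_lt_iff_le

theorem isHorizontalStrip_iff_colLen :
    IsHorizontalStrip μ ν ↔ ∀ j, μ.colLen j ≤ ν.colLen j ∧ ν.colLen j ≤ μ.colLen j + 1 := by
  rw [IsHorizontalStrip, ← transpose_le_iff, le_iff_rowLen, forall_and, forall_comm]
  simp only [rowLen_transpose, mem_iff_lt_colLen, ← Nat.lt_sub_iff_add_lt]
  refine and_congr Iff.rfl (forall_congr' fun j => ?_)
  rw [forall_lt_iff_le, Nat.sub_le_iff_le_add]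

theorem isHorizontalStrip_bot_bot : IsHorizontalStrip ⊥ ⊥ :=
  ⟨le_rfl, by simp⟩

theorem IsHorizontalStrip.eq_bot (h : IsHorizontalStrip μ ⊥) : μ = ⊥ :=
  le_bot_iff.1 h.1

end YoungDiagrams

/-! ### The local rule of the Robinson-Schensted-Knuth correspondence -/

section LocalRule

variable {κ μ ν ρ : YoungDiagram} {k : ℕ}

/-- The row lengths of the diagram produced by `localRule`. -/
def localRuleRow (κ μ ν : YoungDiagram) (k : ℕ) : ℕ → ℕ
  | 0 => max (μ.rowLen 0) (ν.rowLen 0) + k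
  | i + 1 => max (μ.rowLen (i + 1)) (ν.rowLen (i + 1)) +
      (min (μ.rowLen i) (ν.rowLen i) - κ.rowLen i)

/-- Fomin's local rule for the Robinson-Schensted-Knuth correspondence: from the diagrams `κ`, `μ`,
`ν` at three corners of a unit square, where `κ` is opposite to the missing corner, and the entry
`k` of the square to the diagram at the fourth corner. -/
def localRule (κ μ ν : YoungDiagram) (k : ℕ) : YoungDiagram :=
  ofRows (localRuleRow κ μ ν k) (μ.colLen 0 + ν.colLen 0 + 1)

/-- The row lengths of the diagram produced by `localRuleInv`. -/
def localRuleInvRow (μ ν ρ : YoungDiagram) (i : ℕ) : ℕ :=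
  max (μ.rowLen (i + 1)) (ν.rowLen (i + 1)) + (min (μ.rowLen i) (ν.rowLen i) - ρ.rowLen (i + 1))

/-- The inverse of the local rule: it recovers `κ` from `μ`, `ν` and
`ρ = localRule κ μ ν k`. -/
def localRuleInv (μ ν ρ : YoungDiagram) : YoungDiagram :=
  ofRows (localRuleInvRow μ ν ρ) (μ.colLen 0 + ν.colLen 0)

theorem localRule_comm (κ μ ν : YoungDiagram) (k : ℕ) : localRule κ μ ν k = localRule κ ν μ k := by
  have hrow : localRuleRow κ μ ν k = localRuleRow κ ν μ k := by
    funext i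
    cases i <;> simp only [localRuleRow, max_comm, min_comm]
  rw [localRule, localRule, hrow, Nat.add_comm (μ.colLen 0)]

theorem localRuleInv_comm (μ ν ρ : YoungDiagram) : localRuleInv μ ν ρ = localRuleInv ν μ ρ := by
  have hrow : localRuleInvRow μ ν ρ = localRuleInvRow ν μ ρ := by
    funext i
    simp only [localRuleInvRow, max_comm, min_comm]
  rw [localRuleInv, localRuleInv, hrow, Nat.add_comm (μ.colLen 0)]

theorem rowLen_localRule (hμ : IsHorizontalStrip κ μ) (hν : IsHorizontalStrip κ ν) (i : ℕ) :
    (localRule κ μ ν k).rowLen i = localRuleRow κ μ ν k i := by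
  rw [isHorizontalStrip_iff_rowLen] at hμ hν
  refine rowLen_ofRows (antitone_nat_of_succ_le fun i => ?_) ?_ i
  · have := hμ i
    have := hν i
    cases i <;> simp only [localRuleRow] <;> omega
  · have hμN : μ.rowLen (μ.colLen 0 + ν.colLen 0) = 0 := rowLen_eq_zero_iff.2 (by omega)
    have hμN' : μ.rowLen (μ.colLen 0 + ν.colLen 0 + 1) = 0 := rowLen_eq_zero_iff.2 (by omega)
    have hνN' : ν.rowLen (μ.colLen 0 + ν.colLen 0 + 1) = 0 := rowLen_eq_zero_iff.2 (by omega)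
    simp [localRuleRow, hμN, hμN', hνN']

theorem rowLen_localRule_zero (hμ : IsHorizontalStrip κ μ) (hν : IsHorizontalStrip κ ν) :
    (localRule κ μ ν k).rowLen 0 = max (μ.rowLen 0) (ν.rowLen 0) + k :=
  rowLen_localRule hμ hν 0

theorem rowLen_localRule_succ (hμ : IsHorizontalStrip κ μ) (hν : IsHorizontalStrip κ ν) (i : ℕ) :
    (localRule κ μ ν k).rowLen (i + 1) = max (μ.rowLen (i + 1)) (ν.rowLen (i + 1)) +
      (min (μ.rowLen i) (ν.rowLen i) - κ.rowLen i) :=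
  rowLen_localRule hμ hν (i + 1)

theorem rowLen_localRuleInv (hμ : IsHorizontalStrip μ ρ) (hν : IsHorizontalStrip ν ρ) (i : ℕ) :
    (localRuleInv μ ν ρ).rowLen i = max (μ.rowLen (i + 1)) (ν.rowLen (i + 1)) +
      (min (μ.rowLen i) (ν.rowLen i) - ρ.rowLen (i + 1)) := by
  rw [isHorizontalStrip_iff_rowLen] at hμ hν
  refine rowLen_ofRows (antitone_nat_of_succ_le fun i => ?_) ?_ i
  · have := hμ i
    have := hν i
    have := hμ (i + 1)
    have := hν (i + 1)
    have := hμ (i + 1 + 1)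
    have := hν (i + 1 + 1)
    simp only [localRuleInvRow]
    omega
  · have hμN : μ.rowLen (μ.colLen 0 + ν.colLen 0) = 0 := rowLen_eq_zero_iff.2 (by omega)
    have hμN' : μ.rowLen (μ.colLen 0 + ν.colLen 0 + 1) = 0 := rowLen_eq_zero_iff.2 (by omega)
    have hνN' : ν.rowLen (μ.colLen 0 + ν.colLen 0 + 1) = 0 := rowLen_eq_zero_iff.2 (by omega)
    simp [localRuleInvRow, hμN, hμN', hνN']

theorem isHorizontalStrip_localRule_left (hμ : IsHorizontalStrip κ μ)
    (hν : IsHorizontalStrip κ ν) : IsHorizontalStrip μ (localRule κ μ ν k) := by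
  have hzero := rowLen_localRule_zero (k := k) hμ hν
  have hsucc := rowLen_localRule_succ (k := k) hμ hν
  rw [isHorizontalStrip_iff_rowLen] at hμ hν ⊢
  intro i
  have := hμ i
  have := hν i
  refine ⟨?_, by rw [hsucc]; omega⟩
  cases i with
  | zero => omega
  | succ i => rw [hsucc]; omega

theorem isHorizontalStrip_localRule_right (hμ : IsHorizontalStrip κ μ)
    (hν : IsHorizontalStrip κ ν) : IsHorizontalStrip ν (localRule κ μ ν k) :=
  localRule_comm κ ν μ k ▸ isHorizontalStrip_localRule_left hν hμ

theorem isHorizontalStrip_localRuleInv_left (hμ : IsHorizontalStrip μ ρ)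
    (hν : IsHorizontalStrip ν ρ) : IsHorizontalStrip (localRuleInv μ ν ρ) μ := by
  have hrow := rowLen_localRuleInv hμ hν
  rw [isHorizontalStrip_iff_rowLen] at hμ hν ⊢
  intro i
  have := hμ i
  have := hν i
  have := hμ (i + 1)
  have := hν (i + 1)
  rw [hrow]
  omega

theorem isHorizontalStrip_localRuleInv_right (hμ : IsHorizontalStrip μ ρ)
    (hν : IsHorizontalStrip ν ρ) : IsHorizontalStrip (localRuleInv μ ν ρ) ν :=
  localRuleInv_comm ν μ ρ ▸ isHorizontalStrip_localRuleInv_left hν hμ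

theorem localRuleInv_localRule (hμ : IsHorizontalStrip κ μ) (hν : IsHorizontalStrip κ ν) :
    localRuleInv μ ν (localRule κ μ ν k) = κ := by
  refine ext_rowLen fun i => ?_
  rw [rowLen_localRuleInv (isHorizontalStrip_localRule_left hμ hν)
    (isHorizontalStrip_localRule_right hμ hν), rowLen_localRule_succ hμ hν]
  have := isHorizontalStrip_iff_rowLen.1 hμ i
  have := isHorizontalStrip_iff_rowLen.1 hν i
  omega

theorem localRule_localRuleInv (hμ : IsHorizontalStrip μ ρ) (hν : IsHorizontalStrip ν ρ) :
    localRule (localRuleInv μ ν ρ) μ ν (ρ.rowLen 0 - max (μ.rowLen 0) (ν.rowLen 0)) = ρ := by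
  have hμ' := isHorizontalStrip_localRuleInv_left hμ hν
  have hν' := isHorizontalStrip_localRuleInv_right hμ hν
  refine ext_rowLen fun i => ?_
  cases i with
  | zero =>
    rw [rowLen_localRule_zero hμ' hν']
    have := isHorizontalStrip_iff_rowLen.1 hμ 0
    have := isHorizontalStrip_iff_rowLen.1 hν 0
    omega
  | succ i =>
    rw [rowLen_localRule_succ hμ' hν', rowLen_localRuleInv hμ hν]
    have := isHorizontalStrip_iff_rowLen.1 hμ i
    have := isHorizontalStrip_iff_rowLen.1 hν i
    have := isHorizontalStrip_iff_rowLen.1 hμ (i + 1)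
    have := isHorizontalStrip_iff_rowLen.1 hν (i + 1)
    omega

theorem card_localRule (hμ : IsHorizontalStrip κ μ) (hν : IsHorizontalStrip κ ν) :
    (localRule κ μ ν k).card + κ.card = μ.card + ν.card + k := by
  set ρ := localRule κ μ ν k
  obtain ⟨N, hρN, hκN, hμN, hνN⟩ : ∃ N, ρ.colLen 0 ≤ N + 1 ∧ κ.colLen 0 ≤ N ∧
      μ.colLen 0 ≤ N ∧ ν.colLen 0 ≤ N :=
    ⟨ρ.colLen 0 + κ.colLen 0 + μ.colLen 0 + ν.colLen 0, by omega⟩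
  have hstep (i : ℕ) : ρ.rowLen (i + 1) + κ.rowLen i =
      max (μ.rowLen (i + 1)) (ν.rowLen (i + 1)) + min (μ.rowLen i) (ν.rowLen i) := by
    rw [rowLen_localRule_succ hμ hν]
    have := isHorizontalStrip_iff_rowLen.1 hμ i
    have := isHorizontalStrip_iff_rowLen.1 hν i
    omega
  calc ρ.card + κ.card
      = ∑ i ∈ Finset.range N, (ρ.rowLen (i + 1) + κ.rowLen i) + ρ.rowLen 0 := by
        rw [card_eq_sum_rowLen hρN, card_eq_sum_rowLen hκN, Finset.sum_range_succ',
          Finset.sum_add_distrib]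
        ring
    _ = ∑ i ∈ Finset.range (N + 1), max (μ.rowLen i) (ν.rowLen i) +
          ∑ i ∈ Finset.range N, min (μ.rowLen i) (ν.rowLen i) + k := by
        rw [Finset.sum_congr rfl fun i _ => hstep i, Finset.sum_add_distrib,
          rowLen_localRule_zero hμ hν, Finset.sum_range_succ']
        ring
    _ = ∑ i ∈ Finset.range N, (max (μ.rowLen i) (ν.rowLen i) + min (μ.rowLen i) (ν.rowLen i)) +
          k := by
        rw [Finset.sum_range_succ, rowLen_eq_zero_iff.2 hμN, rowLen_eq_zero_iff.2 hνN, max_self,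
          add_zero, Finset.sum_add_distrib]
    _ = μ.card + ν.card + k := by
        simp only [max_add_min, Finset.sum_add_distrib, card_eq_sum_rowLen hμN,
          card_eq_sum_rowLen hνN]

end LocalRule

/-! ### Inserting a row into a chain of horizontal strips -/

section Rows

variable {n : ℕ} {p q : Fin (n + 1) → YoungDiagram} {μ : YoungDiagram}

/-- A chain `∅ = p 0, p 1, …, p n` in which `p (i + 1) / p i` is a horizontal strip for all `i`.
Such chains encode the semistandard tableaux of shape `p n` with entries in `{1, …, n}`. -/
def IsStripChain {n : ℕ} (p : Fin (n + 1) → YoungDiagram) : Prop :=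
  p 0 = ⊥ ∧ ∀ i : Fin n, IsHorizontalStrip (p i.castSucc) (p i.succ)

theorem IsStripChain.monotone (hp : IsStripChain p) : Monotone p :=
  Fin.monotone_iff_le_succ.2 fun i => (hp.2 i).1

theorem IsStripChain.colLen_zero_le (hp : IsStripChain p) (i : Fin (n + 1)) :
    (p i).colLen 0 ≤ i := by
  induction i using Fin.induction with
  | zero => simp [hp.1]
  | succ i ih =>
    have := (isHorizontalStrip_iff_colLen.1 (hp.2 i) 0).2
    simp only [Fin.val_castSucc, Fin.val_succ] at ih ⊢
    omega

/-- One row of the growth diagram of the Robinson-Schensted-Knuth correspondence: the chain `q` is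
the row below, and `y` are the entries of the squares between the two rows. -/
def insertRow (q : Fin (n + 1) → YoungDiagram) (y : Fin n → ℕ) : Fin (n + 1) → YoungDiagram :=
  Fin.induction ⊥ fun j ρ => localRule (q j.castSucc) (q j.succ) ρ (y j)

/-- The inverse of `insertRow`, which recovers the lower row from the upper one and from the last
diagram `μ` of the lower one. -/
def deleteRow (q : Fin (n + 1) → YoungDiagram) (μ : YoungDiagram) : Fin (n + 1) → YoungDiagram :=
  Fin.reverseInduction μ fun j ν => localRuleInv ν (q j.castSucc) (q j.succ)

/-- The entries of the squares between two adjacent rows `p`, `q` of a growth diagram. -/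
def rowEntries (p q : Fin (n + 1) → YoungDiagram) (j : Fin n) : ℕ :=
  (q j.succ).rowLen 0 - max ((p j.succ).rowLen 0) ((q j.castSucc).rowLen 0)

@[simp] theorem insertRow_zero (q : Fin (n + 1) → YoungDiagram) (y : Fin n → ℕ) :
    insertRow q y 0 = ⊥ :=
  rfl

theorem insertRow_succ (q : Fin (n + 1) → YoungDiagram) (y : Fin n → ℕ) (j : Fin n) :
    insertRow q y j.succ =
      localRule (q j.castSucc) (q j.succ) (insertRow q y j.castSucc) (y j) :=
  Fin.induction_succ ..

@[simp] theorem deleteRow_last (q : Fin (n + 1) → YoungDiagram) (μ : YoungDiagram) :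
    deleteRow q μ (Fin.last n) = μ :=
  Fin.reverseInduction_last ..

theorem deleteRow_castSucc (q : Fin (n + 1) → YoungDiagram) (μ : YoungDiagram) (j : Fin n) :
    deleteRow q μ j.castSucc =
      localRuleInv (deleteRow q μ j.succ) (q j.castSucc) (q j.succ) :=
  Fin.reverseInduction_castSucc ..

theorem IsStripChain.isHorizontalStrip_insertRow (hq : IsStripChain q) (y : Fin n → ℕ)
    (j : Fin (n + 1)) : IsHorizontalStrip (q j) (insertRow q y j) := by
  induction j using Fin.induction with
  | zero => simpa [hq.1] using isHorizontalStrip_bot_bot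
  | succ j ih =>
    rw [insertRow_succ]
    exact isHorizontalStrip_localRule_left (hq.2 j) ih

theorem isStripChain_insertRow (hq : IsStripChain q) (y : Fin n → ℕ) :
    IsStripChain (insertRow q y) := by
  refine ⟨rfl, fun j => ?_⟩
  rw [insertRow_succ]
  exact isHorizontalStrip_localRule_right (hq.2 j) (hq.isHorizontalStrip_insertRow y _)

theorem IsStripChain.rowLen_zero_insertRow_succ (hq : IsStripChain q) (y : Fin n → ℕ)
    (j : Fin n) : (insertRow q y j.succ).rowLen 0 =
      max ((q j.succ).rowLen 0) ((insertRow q y j.castSucc).rowLen 0) + y j := by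
  rw [insertRow_succ, rowLen_localRule_zero (hq.2 j) (hq.isHorizontalStrip_insertRow y _)]

theorem IsStripChain.card_insertRow_succ (hq : IsStripChain q) (y : Fin n → ℕ) (j : Fin n) :
    (insertRow q y j.succ).card + (q j.castSucc).card =
      (q j.succ).card + (insertRow q y j.castSucc).card + y j := by
  rw [insertRow_succ, card_localRule (hq.2 j) (hq.isHorizontalStrip_insertRow y _)]

theorem IsStripChain.card_insertRow_last (hq : IsStripChain q) (y : Fin n → ℕ) :
    (insertRow q y (Fin.last n)).card = (q (Fin.last n)).card + ∑ j, y j := by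
  have hsum := Finset.sum_congr rfl fun j (_ : j ∈ Finset.univ) => hq.card_insertRow_succ y j
  have htop := (Fin.sum_univ_succ fun j => (insertRow q y j).card).symm.trans
    (Fin.sum_univ_castSucc _)
  have hbot := (Fin.sum_univ_succ fun j => (q j).card).symm.trans (Fin.sum_univ_castSucc _)
  rw [insertRow_zero] at htop
  rw [hq.1] at hbot
  simp only [Finset.sum_add_distrib] at hsum
  omega

theorem IsStripChain.isHorizontalStrip_deleteRow (hq : IsStripChain q)
    (hμ : IsHorizontalStrip μ (q (Fin.last n))) (j : Fin (n + 1)) :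
    IsHorizontalStrip (deleteRow q μ j) (q j) := by
  induction j using Fin.reverseInduction with
  | last => rwa [deleteRow_last]
  | cast j ih =>
    rw [deleteRow_castSucc]
    exact isHorizontalStrip_localRuleInv_right ih (hq.2 j)

theorem isStripChain_deleteRow (hq : IsStripChain q)
    (hμ : IsHorizontalStrip μ (q (Fin.last n))) : IsStripChain (deleteRow q μ) := by
  have hvert := hq.isHorizontalStrip_deleteRow hμ
  refine ⟨(hq.1 ▸ hvert 0).eq_bot, fun j => ?_⟩
  rw [deleteRow_castSucc]
  exact isHorizontalStrip_localRuleInv_left (hvert j.succ) (hq.2 j)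

theorem IsStripChain.deleteRow_insertRow (hq : IsStripChain q) (y : Fin n → ℕ) :
    deleteRow (insertRow q y) (q (Fin.last n)) = q := by
  funext j
  induction j using Fin.reverseInduction with
  | last => rw [deleteRow_last]
  | cast j ih =>
    rw [deleteRow_castSucc, ih, insertRow_succ,
      localRuleInv_localRule (hq.2 j) (hq.isHorizontalStrip_insertRow y _)]

theorem IsStripChain.rowEntries_insertRow (hq : IsStripChain q) (y : Fin n → ℕ) :
    rowEntries q (insertRow q y) = y := by
  funext j
  rw [rowEntries, hq.rowLen_zero_insertRow_succ, Nat.add_sub_cancel_left]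

theorem IsStripChain.insertRow_deleteRow (hq : IsStripChain q)
    (hμ : IsHorizontalStrip μ (q (Fin.last n))) :
    insertRow (deleteRow q μ) (rowEntries (deleteRow q μ) q) = q := by
  funext j
  induction j using Fin.induction with
  | zero => rw [insertRow_zero, hq.1]
  | succ j ih =>
    rw [insertRow_succ, ih, deleteRow_castSucc]
    exact localRule_localRuleInv (hq.isHorizontalStrip_deleteRow hμ _) (hq.2 j)

end Rows

/-! ### Growth diagrams and last passage times -/

section Growth

variable {m n : ℕ}

/-- The growth diagram of the Robinson-Schensted-Knuth correspondence for the matrix `x`. -/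
def growth (x : Fin m → Fin n → ℕ) : Fin (m + 1) → Fin (n + 1) → YoungDiagram :=
  Fin.induction (fun _ => ⊥) fun i q => insertRow q (x i)

/-- The shape of the pair of tableaux which the Robinson-Schensted-Knuth correspondence associates
to the matrix `x`. -/
def shape (x : Fin m → Fin n → ℕ) : YoungDiagram :=
  growth x (Fin.last m) (Fin.last n)

@[simp] theorem growth_zero_left (x : Fin m → Fin n → ℕ) (j : Fin (n + 1)) : growth x 0 j = ⊥ :=
  rfl

theorem growth_succ (x : Fin m → Fin n → ℕ) (i : Fin m) :
    growth x i.succ = insertRow (growth x i.castSucc) (x i) :=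
  Fin.induction_succ ..

theorem growth_castSucc (x : Fin (m + 1) → Fin n → ℕ) (i : Fin (m + 1)) :
    growth x i.castSucc = growth (Fin.init x) i := by
  induction i using Fin.induction with
  | zero => rfl
  | succ i ih => rw [← Fin.succ_castSucc, growth_succ, growth_succ, ih, Fin.init]

theorem growth_last_succ (x : Fin (m + 1) → Fin n → ℕ) :
    growth x (Fin.last (m + 1)) =
      insertRow (growth (Fin.init x) (Fin.last m)) (x (Fin.last m)) := by
  rw [← Fin.succ_last, growth_succ, growth_castSucc]

theorem isStripChain_growth (x : Fin m → Fin n → ℕ) (i : Fin (m + 1)) :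
    IsStripChain (growth x i) := by
  induction i using Fin.induction with
  | zero => exact ⟨rfl, fun _ => isHorizontalStrip_bot_bot⟩
  | succ i ih => exact growth_succ x i ▸ isStripChain_insertRow ih (x i)

@[simp] theorem growth_zero_right (x : Fin m → Fin n → ℕ) (i : Fin (m + 1)) : growth x i 0 = ⊥ :=
  (isStripChain_growth x i).1

theorem growth_monotone (x : Fin m → Fin n → ℕ) : Monotone (growth x) :=
  Fin.monotone_iff_le_succ.2 fun i j =>
    growth_succ x i ▸ ((isStripChain_growth x _).isHorizontalStrip_insertRow (x i) j).1

theorem rowLen_zero_growth_succ_succ (x : Fin m → Fin n → ℕ) (i : Fin m) (j : Fin n) :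
    (growth x i.succ j.succ).rowLen 0 = max ((growth x i.castSucc j.succ).rowLen 0)
      ((growth x i.succ j.castSucc).rowLen 0) + x i j := by
  rw [growth_succ, (isStripChain_growth x _).rowLen_zero_insertRow_succ]

theorem le_rowLen_zero_shape (x : Fin m → Fin n → ℕ) (i : Fin m) (j : Fin n) :
    x i j ≤ (shape x).rowLen 0 :=
  calc x i j ≤ (growth x i.succ j.succ).rowLen 0 := by
        rw [rowLen_zero_growth_succ_succ]
        exact Nat.le_add_left ..
    _ ≤ (growth x i.succ (Fin.last n)).rowLen 0 :=
        le_iff_rowLen.1 ((isStripChain_growth x _).monotone (Fin.le_last _)) 0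
    _ ≤ (shape x).rowLen 0 := le_iff_rowLen.1 (growth_monotone x (Fin.le_last _) _) 0

theorem finite_setOf_rowLen_zero_shape_le (m n l : ℕ) :
    {x : Fin m → Fin n → ℕ | (shape x).rowLen 0 ≤ l}.Finite :=
  (Set.finite_Iic fun _ _ => l).subset fun x hx i j => (le_rowLen_zero_shape x i j).trans hx

end Growth

section LastPassage

variable {n : ℕ}

theorem step_iff {r q : Fin n × Fin n} :
    Step r q ↔ (r.1.succ = q.1.castSucc ∧ r.2 = q.2) ∨ (r.1 = q.1 ∧ r.2.succ = q.2.castSucc) := by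
  simp [Step, Fin.ext_iff]

theorem sum_le_rowLen_zero_growth (x : Fin n → Fin n → ℕ) {p : List (Fin n × Fin n)}
    {q : Fin n × Fin n} (hlast : p.getLast? = some q) (hchain : p.IsChain Step) :
    (p.map fun r => x r.1 r.2).sum ≤ (growth x q.1.succ q.2.succ).rowLen 0 := by
  induction p using List.reverseRecOn generalizing q with
  | nil => simp
  | append_singleton p s ih =>
    obtain rfl : s = q := by simpa using hlast
    obtain ⟨hp, -, hstep⟩ := List.isChain_append.1 hchain
    rw [rowLen_zero_growth_succ_succ, List.map_append, List.sum_append, List.map_singleton,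
      List.sum_singleton]
    refine Nat.add_le_add_right ?_ _
    rcases hpr : p.getLast? with - | r
    · simp [List.getLast?_eq_none_iff.1 hpr]
    · refine (ih hpr hp).trans (le_max_iff.2 ?_)
      rcases step_iff.1 (hstep r hpr s rfl) with ⟨h₁, h₂⟩ | ⟨h₁, h₂⟩
      · exact Or.inl (by rw [h₁, h₂])
      · exact Or.inr (by rw [h₁, h₂])

variable [NeZero n]

theorem exists_step_rowLen_zero_growth_eq (x : Fin n → Fin n → ℕ) {q : Fin n × Fin n}
    (hq : q ≠ (0, 0)) : ∃ r, Step r q ∧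
      (growth x q.1.succ q.2.succ).rowLen 0 =
        (growth x r.1.succ r.2.succ).rowLen 0 + x q.1 q.2 := by
  obtain ⟨i, j⟩ := q
  rw [rowLen_zero_growth_succ_succ]
  have hcases : (i.castSucc ≠ 0 ∧
        (growth x i.succ j.castSucc).rowLen 0 ≤ (growth x i.castSucc j.succ).rowLen 0) ∨
      (j.castSucc ≠ 0 ∧
        (growth x i.castSucc j.succ).rowLen 0 ≤ (growth x i.succ j.castSucc).rowLen 0) := by
    by_cases hi : i = 0
    · exact Or.inr ⟨by simpa [hi] using hq, by simp [hi]⟩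
    by_cases hj : j = 0
    · exact Or.inl ⟨by simpa using hi, by simp [hj]⟩
    · simpa [hi, hj] using le_total _ _
  rcases hcases with ⟨hi, hle⟩ | ⟨hj, hle⟩
  · obtain ⟨i', hi'⟩ := Fin.exists_succ_eq.2 hi
    exact ⟨(i', j), step_iff.2 (Or.inl ⟨hi', rfl⟩), by rw [max_eq_left hle, hi']⟩
  · obtain ⟨j', hj'⟩ := Fin.exists_succ_eq.2 hj
    exact ⟨(i, j'), step_iff.2 (Or.inr ⟨rfl, hj'⟩), by rw [max_eq_right hle, hj']⟩

theorem exists_path_sum_eq_rowLen_zero_growth (x : Fin n → Fin n → ℕ) (q : Fin n × Fin n) :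
    ∃ p : List (Fin n × Fin n), p.head? = some (0, 0) ∧ p.getLast? = some q ∧ p.IsChain Step ∧
      (p.map fun r => x r.1 r.2).sum = (growth x q.1.succ q.2.succ).rowLen 0 := by
  induction q using WellFoundedLT.induction with
  | ind q ih =>
    by_cases hq : q = (0, 0)
    · subst hq
      refine ⟨[(0, 0)], rfl, rfl, List.isChain_singleton _, ?_⟩
      rw [rowLen_zero_growth_succ_succ]
      simp
    · obtain ⟨r, hstep, hmax⟩ := exists_step_rowLen_zero_growth_eq x hq
      obtain ⟨p, hhead, hlast, hchain, hsum⟩ := ih r hstep.lt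
      refine ⟨p ++ [q], by simp [hhead], by simp, ?_, by simp [hsum, hmax]⟩
      refine List.isChain_append.2 ⟨hchain, List.isChain_singleton _, ?_⟩
      simpa [hlast] using hstep

theorem lastPassageTime_eq_rowLen_zero_shape (x : Fin n → Fin n → ℕ) :
    lastPassageTime x = (shape x).rowLen 0 := by
  rw [shape, ← Fin.top_eq_last, ← Fin.succ_top]
  refine (isGreatest_lastPassageTime x).unique ⟨?_, ?_⟩
  · obtain ⟨p, hhead, hlast, hchain, hsum⟩ := exists_path_sum_eq_rowLen_zero_growth x (⊤, ⊤)
    exact ⟨p, ⟨hhead, hlast, hchain⟩, hsum.symm⟩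
  · rintro _ ⟨p, ⟨-, hlast, hchain⟩, rfl⟩
    simpa only using sum_le_rowLen_zero_growth x hlast hchain

end LastPassage

/-! ### Schur polynomials and the Cauchy identity -/

section Schur

variable {R : Type*} [CommSemiring R] {n : ℕ}

theorem finite_setOf_colLen_zero_le_rowLen_zero_le (n l : ℕ) :
    {μ : YoungDiagram | μ.colLen 0 ≤ n ∧ μ.rowLen 0 ≤ l}.Finite := by
  refine Set.Finite.of_finite_image (f := cells) ?_ fun μ _ ν _ h => YoungDiagram.ext h
  refine ((Finset.range n ×ˢ Finset.range l).powerset.finite_toSet).subset ?_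
  rintro _ ⟨μ, ⟨hcol, hrow⟩, rfl⟩
  rw [Finset.mem_coe, Finset.mem_powerset]
  rintro ⟨i, j⟩ hij
  have hi := mem_iff_lt_colLen.1 (μ.up_left_mem le_rfl j.zero_le hij)
  have hj := mem_iff_lt_rowLen.1 (μ.up_left_mem i.zero_le le_rfl hij)
  exact Finset.mem_product.2
    ⟨Finset.mem_range.2 (hi.trans_le hcol), Finset.mem_range.2 (hj.trans_le hrow)⟩

theorem finite_Iic_youngDiagram (ν : YoungDiagram) : (Set.Iic ν).Finite :=
  (finite_setOf_colLen_zero_le_rowLen_zero_le (ν.colLen 0) (ν.rowLen 0)).subset fun μ hμ =>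
    ⟨by simpa using le_iff_rowLen.1 (transpose_le_iff.2 hμ) 0, le_iff_rowLen.1 hμ 0⟩

/-- The Young diagrams with at most `n` rows and at most `l` columns. -/
noncomputable def boxDiagrams (n l : ℕ) : Finset YoungDiagram :=
  (finite_setOf_colLen_zero_le_rowLen_zero_le n l).toFinset

/-- The Young diagrams obtained from `ν` by removing a horizontal strip. -/
noncomputable def removeStrips (ν : YoungDiagram) : Finset YoungDiagram :=
  ((finite_Iic_youngDiagram ν).subset
    (fun _ hμ => hμ.1 : {μ | IsHorizontalStrip μ ν} ⊆ Set.Iic ν)).toFinset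

theorem finite_setOf_isStripChain (n : ℕ) (μ : YoungDiagram) :
    {p : Fin (n + 1) → YoungDiagram | IsStripChain p ∧ p (Fin.last n) = μ}.Finite :=
  (Set.Finite.pi' fun _ => finite_Iic_youngDiagram μ).subset fun _ hp i =>
    (hp.1.monotone (Fin.le_last i)).trans_eq hp.2

/-- The chains of horizontal strips of length `n` which end at `μ`, that is, the semistandard
tableaux of shape `μ` with entries in `{1, …, n}`. -/
noncomputable def stripChains (n : ℕ) (μ : YoungDiagram) : Finset (Fin (n + 1) → YoungDiagram) :=
  (finite_setOf_isStripChain n μ).toFinset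

/-- The value of the Schur polynomial of shape `μ` at `b 0, …, b (n - 1)`: the exponent of `b i` in
the monomial of a semistandard tableau is the size of the `i`-th horizontal strip. -/
noncomputable def schur (b : Fin n → R) (μ : YoungDiagram) : R :=
  ∑ p ∈ stripChains n μ, ∏ i : Fin n, b i ^ ((p i.succ).card - (p i.castSucc).card)

@[simp] theorem mem_boxDiagrams {n l : ℕ} {μ : YoungDiagram} :
    μ ∈ boxDiagrams n l ↔ μ.colLen 0 ≤ n ∧ μ.rowLen 0 ≤ l := by
  simp [boxDiagrams]

@[simp] theorem mem_removeStrips {μ ν : YoungDiagram} :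
    μ ∈ removeStrips ν ↔ IsHorizontalStrip μ ν := by
  simp [removeStrips]

@[simp] theorem mem_stripChains {μ : YoungDiagram} {p : Fin (n + 1) → YoungDiagram} :
    p ∈ stripChains n μ ↔ IsStripChain p ∧ p (Fin.last n) = μ := by
  simp [stripChains]

theorem isStripChain_succ_iff {p : Fin (n + 2) → YoungDiagram} :
    IsStripChain p ↔ IsStripChain (Fin.init p) ∧
      IsHorizontalStrip (p (Fin.last n).castSucc) (p (Fin.last (n + 1))) := by
  simp only [IsStripChain, Fin.init, Fin.castSucc_zero, Fin.forall_fin_succ' (n := n), and_assoc,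
    Fin.succ_castSucc, Fin.succ_last]

theorem sum_stripChains_succ {M : Type*} [AddCommMonoid M] (ν : YoungDiagram)
    (f : (Fin (n + 2) → YoungDiagram) → M) :
    ∑ p ∈ stripChains (n + 1) ν, f p =
      ∑ μ ∈ removeStrips ν, ∑ p ∈ stripChains n μ, f (Fin.snoc p ν) := by
  rw [Finset.sum_sigma']
  refine Finset.sum_nbij' (fun p => ⟨p (Fin.last n).castSucc, Fin.init p⟩)
    (fun c => Fin.snoc c.2 ν) ?_ ?_ ?_ ?_ ?_
  · intro p hp
    obtain ⟨hchain, rfl⟩ := mem_stripChains.1 hp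
    obtain ⟨hinit, hstrip⟩ := isStripChain_succ_iff.1 hchain
    exact Finset.mem_sigma.2 ⟨mem_removeStrips.2 hstrip, mem_stripChains.2 ⟨hinit, rfl⟩⟩
  · rintro ⟨μ, p⟩ hp
    simp only [Finset.mem_sigma, mem_removeStrips, mem_stripChains] at hp
    obtain ⟨hstrip, hchain, rfl⟩ := hp
    refine mem_stripChains.2 ⟨isStripChain_succ_iff.2 ?_, Fin.snoc_last ..⟩
    rw [Fin.init_snoc, Fin.snoc_castSucc, Fin.snoc_last]
    exact ⟨hchain, hstrip⟩
  · intro p hp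
    obtain ⟨-, rfl⟩ := mem_stripChains.1 hp
    exact Fin.snoc_init_self p
  · rintro ⟨μ, p⟩ hp
    simp only [Finset.mem_sigma, mem_stripChains] at hp
    obtain ⟨-, -, rfl⟩ := hp
    simp only [Fin.init_snoc, Fin.snoc_castSucc]
  · intro p hp
    obtain ⟨-, rfl⟩ := mem_stripChains.1 hp
    exact congrArg f (Fin.snoc_init_self p).symm

theorem stripChains_zero_bot : stripChains 0 ⊥ = {fun _ => ⊥} := by
  ext p
  simp [IsStripChain, funext_iff, Fin.last_zero]

theorem stripChains_zero_of_ne_bot {μ : YoungDiagram} (hμ : μ ≠ ⊥) : stripChains 0 μ = ∅ :=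
  Finset.eq_empty_of_forall_notMem fun _ hp =>
    hμ ((mem_stripChains.1 hp).2.symm.trans (mem_stripChains.1 hp).1.1)

theorem schur_zero_bot (b : Fin 0 → R) : schur b ⊥ = 1 := by
  simp [schur, stripChains_zero_bot]

theorem schur_zero_of_ne_bot (b : Fin 0 → R) {μ : YoungDiagram} (hμ : μ ≠ ⊥) : schur b μ = 0 := by
  rw [schur, stripChains_zero_of_ne_bot hμ, Finset.sum_empty]

theorem schur_eq_zero_of_lt_colLen_zero (b : Fin n → R) {μ : YoungDiagram} (hμ : n < μ.colLen 0) :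
    schur b μ = 0 := by
  refine Finset.sum_eq_zero fun p hp => absurd hμ (not_lt_of_ge ?_)
  obtain ⟨hchain, rfl⟩ := mem_stripChains.1 hp
  exact hchain.colLen_zero_le _

theorem schur_succ (b : Fin (n + 1) → R) (ν : YoungDiagram) :
    schur b ν = ∑ μ ∈ removeStrips ν,
      schur (Fin.init b) μ * b (Fin.last n) ^ (ν.card - μ.card) := by
  rw [schur, sum_stripChains_succ]
  refine Finset.sum_congr rfl fun μ _ => ?_
  rw [schur, Finset.sum_mul]
  refine Finset.sum_congr rfl fun p hp => ?_
  obtain ⟨-, rfl⟩ := mem_stripChains.1 hp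
  rw [Fin.prod_univ_castSucc]
  simp only [Fin.succ_castSucc, Fin.snoc_castSucc, Fin.succ_last, Fin.snoc_last, Fin.init]

end Schur

section Cauchy

variable {R : Type*} [CommSemiring R] {m n : ℕ}

theorem finite_setOf_growth_last_eq (m : ℕ) (q : Fin (n + 1) → YoungDiagram) :
    {x : Fin m → Fin n → ℕ | growth x (Fin.last m) = q}.Finite :=
  (finite_setOf_rowLen_zero_shape_le m n ((q (Fin.last n)).rowLen 0)).subset fun x hx => by
    rw [Set.mem_ofPred_eq, shape, hx]

/-- The matrices with `m` rows whose growth diagram has last row `q`. -/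
noncomputable def growthFiber (m : ℕ) (q : Fin (n + 1) → YoungDiagram) :
    Finset (Fin m → Fin n → ℕ) :=
  (finite_setOf_growth_last_eq m q).toFinset

@[simp] theorem mem_growthFiber {q : Fin (n + 1) → YoungDiagram} {x : Fin m → Fin n → ℕ} :
    x ∈ growthFiber m q ↔ growth x (Fin.last m) = q := by
  simp [growthFiber]

theorem sum_growthFiber_succ {M : Type*} [AddCommMonoid M] {q : Fin (n + 1) → YoungDiagram}
    (hq : IsStripChain q) (f : (Fin (m + 1) → Fin n → ℕ) → M) :
    ∑ x ∈ growthFiber (m + 1) q, f x =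
      ∑ μ ∈ removeStrips (q (Fin.last n)), ∑ x ∈ growthFiber m (deleteRow q μ),
        f (Fin.snoc x (rowEntries (deleteRow q μ) q)) := by
  have hinsert {x : Fin (m + 1) → Fin n → ℕ} (hx : x ∈ growthFiber (m + 1) q) :
      insertRow (growth (Fin.init x) (Fin.last m)) (x (Fin.last m)) = q := by
    rw [← growth_last_succ, mem_growthFiber.1 hx]
  have hdelete {x : Fin (m + 1) → Fin n → ℕ} (hx : x ∈ growthFiber (m + 1) q) :
      deleteRow q (shape (Fin.init x)) = growth (Fin.init x) (Fin.last m) := by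
    rw [← hinsert hx, shape, (isStripChain_growth _ _).deleteRow_insertRow]
  have hentries {x : Fin (m + 1) → Fin n → ℕ} (hx : x ∈ growthFiber (m + 1) q) :
      rowEntries (deleteRow q (shape (Fin.init x))) q = x (Fin.last m) := by
    rw [hdelete hx, ← hinsert hx, (isStripChain_growth _ _).rowEntries_insertRow]
  rw [Finset.sum_sigma']
  refine Finset.sum_nbij' (fun x => ⟨shape (Fin.init x), Fin.init x⟩)
    (fun c => Fin.snoc c.2 (rowEntries (deleteRow q c.1) q)) ?_ ?_ ?_ ?_ ?_
  · intro x hx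
    refine Finset.mem_sigma.2 ⟨mem_removeStrips.2 ?_, mem_growthFiber.2 (hdelete hx).symm⟩
    exact hinsert hx ▸ (isStripChain_growth _ _).isHorizontalStrip_insertRow _ _
  · rintro ⟨μ, x⟩ hx
    simp only [Finset.mem_sigma, mem_removeStrips, mem_growthFiber] at hx
    rw [mem_growthFiber, growth_last_succ, Fin.init_snoc, Fin.snoc_last, hx.2,
      hq.insertRow_deleteRow hx.1]
  · intro x hx
    rw [hentries hx, Fin.snoc_init_self]
  · rintro ⟨μ, x⟩ hx
    simp only [Finset.mem_sigma, mem_growthFiber] at hx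
    have hshape : shape x = μ := by rw [shape, hx.2, deleteRow_last]
    simp only [Fin.init_snoc, hshape]
  · intro x hx
    rw [hentries hx, Fin.snoc_init_self]

theorem sum_growthFiber_prod_pow (a : Fin m → R) {q : Fin (n + 1) → YoungDiagram}
    (hq : IsStripChain q) :
    ∑ x ∈ growthFiber m q, ∏ i, a i ^ ∑ j, x i j = schur a (q (Fin.last n)) := by
  induction m generalizing q with
  | zero =>
    by_cases hbot : q (Fin.last n) = ⊥
    · have hq' : q = fun _ => ⊥ := funext fun j =>
        le_bot_iff.1 ((hq.monotone (Fin.le_last j)).trans_eq hbot)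
      have hfiber : growthFiber 0 q = Finset.univ := by
        ext x
        simp [hq', funext_iff, Fin.last_zero]
      simp [hbot, hfiber, schur_zero_bot]
    · rw [schur_zero_of_ne_bot a hbot]
      refine Finset.sum_eq_zero fun x hx => absurd ?_ hbot
      rw [← mem_growthFiber.1 hx]
      rfl
  | succ m ih =>
    rw [sum_growthFiber_succ hq, schur_succ]
    refine Finset.sum_congr rfl fun μ hμ => ?_
    have hstrip := mem_removeStrips.1 hμ
    have hchain := isStripChain_deleteRow hq hstrip
    have hcard : (q (Fin.last n)).card - μ.card = ∑ j, rowEntries (deleteRow q μ) q j := by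
      have := hchain.card_insertRow_last (rowEntries (deleteRow q μ) q)
      rw [hq.insertRow_deleteRow hstrip, deleteRow_last] at this
      omega
    have hih := ih (Fin.init a) hchain
    rw [deleteRow_last] at hih
    rw [← hih, hcard, Finset.sum_mul]
    refine Finset.sum_congr rfl fun x _ => ?_
    simp only [Fin.prod_univ_castSucc, Fin.snoc_castSucc, Fin.snoc_last, Fin.init]

theorem card_growth_last_succ (x : Fin m → Fin n → ℕ) (j : Fin n) :
    (growth x (Fin.last m) j.succ).card =
      (growth x (Fin.last m) j.castSucc).card + ∑ i, x i j := by
  induction m with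
  | zero => simp [Fin.last_zero]
  | succ m ih =>
    have hrow := (isStripChain_growth (Fin.init x) (Fin.last m)).card_insertRow_succ
      (x (Fin.last m)) j
    have hinit := ih (Fin.init x)
    simp only [Fin.init] at hinit
    rw [growth_last_succ, Fin.sum_univ_castSucc]
    omega

theorem sum_growthFiber_prod_mul_pow (a : Fin m → R) (b : Fin n → R)
    {q : Fin (n + 1) → YoungDiagram} (hq : IsStripChain q) :
    ∑ x ∈ growthFiber m q, ∏ i, ∏ j, (a i * b j) ^ x i j =
      schur a (q (Fin.last n)) * ∏ j : Fin n, b j ^ ((q j.succ).card - (q j.castSucc).card) := by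
  rw [← sum_growthFiber_prod_pow a hq, Finset.sum_mul]
  refine Finset.sum_congr rfl fun x hx => ?_
  obtain rfl := mem_growthFiber.1 hx
  simp only [card_growth_last_succ, Nat.add_sub_cancel_left, mul_pow, Finset.prod_mul_distrib,
    Finset.prod_pow_eq_pow_sum]
  rw [Finset.prod_comm]
  simp only [Finset.prod_pow_eq_pow_sum]

theorem sum_prod_mul_pow_eq_sum_schur_mul_schur (a : Fin m → R) (b : Fin n → R) (l : ℕ) :
    ∑ x ∈ (finite_setOf_rowLen_zero_shape_le m n l).toFinset, ∏ i, ∏ j, (a i * b j) ^ x i j =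
      ∑ μ ∈ boxDiagrams n l, schur a μ * schur b μ := by
  have hfiber (μ : YoungDiagram) : schur a μ * schur b μ =
      ∑ q ∈ stripChains n μ, ∑ x ∈ growthFiber m q, ∏ i, ∏ j, (a i * b j) ^ x i j := by
    rw [schur.eq_def b, Finset.mul_sum]
    refine Finset.sum_congr rfl fun q hq => ?_
    obtain ⟨hchain, rfl⟩ := mem_stripChains.1 hq
    rw [sum_growthFiber_prod_mul_pow a b hchain]
  rw [Finset.sum_congr rfl fun μ _ => hfiber μ, Finset.sum_sigma', Finset.sum_sigma']
  refine Finset.sum_nbij' (fun x => ⟨⟨shape x, growth x (Fin.last m)⟩, x⟩) (fun c => c.2)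
    ?_ ?_ ?_ ?_ ?_
  · intro x hx
    have hchain := isStripChain_growth x (Fin.last m)
    have hrow : (shape x).rowLen 0 ≤ l := by simpa using hx
    simp only [Finset.mem_sigma, mem_boxDiagrams, mem_stripChains, mem_growthFiber]
    exact ⟨⟨⟨hchain.colLen_zero_le (Fin.last n), hrow⟩, hchain, rfl⟩, trivial⟩
  · rintro ⟨⟨μ, q⟩, x⟩ hx
    simp only [Finset.mem_sigma, mem_boxDiagrams, mem_stripChains, mem_growthFiber] at hx
    obtain ⟨⟨⟨-, hrow⟩, -, rfl⟩, rfl⟩ := hx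
    simpa [shape] using hrow
  · exact fun _ _ => rfl
  · rintro ⟨⟨μ, q⟩, x⟩ hx
    simp only [Finset.mem_sigma, mem_stripChains, mem_growthFiber] at hx
    obtain ⟨⟨-, -, rfl⟩, rfl⟩ := hx
    rfl
  · exact fun _ _ => rfl

end Cauchy

/-! ### Alternants and the dual Cauchy identity -/

section Alternants

variable {R : Type*} [CommRing R] {l : ℕ}

/-- The alternant `det (z k ^ s j)`. When `s` is strictly increasing, its quotient by the
Vandermonde determinant is a character of the unitary group. -/
def alternant (s : Fin l → ℕ) (z : Fin l → R) : R :=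
  (Matrix.of fun j k => z k ^ s j).det

theorem alternant_eq_zero_of_not_injective {s : Fin l → ℕ} (z : Fin l → R)
    (hs : ¬ Function.Injective s) : alternant s z = 0 := by
  simp only [Function.Injective, not_forall] at hs
  obtain ⟨i, j, hij, hne⟩ := hs
  exact Matrix.det_zero_of_row_eq hne (funext fun k => by simp only [Matrix.of_apply, hij])

theorem alternant_val (z : Fin l → R) :
    alternant (fun j : Fin l => (j : ℕ)) z = ∏ j, ∏ k ∈ Finset.Ioi j, (z k - z j) := by
  rw [← Matrix.det_vandermonde, ← Matrix.det_transpose, alternant]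
  rfl

theorem prod_one_add_mul_mul_alternant (b : R) (s : Fin l → ℕ) (z : Fin l → R) :
    (∏ k, (1 + b * z k)) * alternant s z =
      ∑ t ∈ Fintype.piFinset fun j => {s j, s j + 1},
        b ^ (∑ j, (t j - s j)) * alternant t z := by
  have hrow : (Matrix.of fun j k => (1 + b * z k) * Matrix.of (fun j k => z k ^ s j) j k) =
      fun j => ∑ e ∈ {s j, s j + 1}, b ^ (e - s j) • fun k => z k ^ e := by
    funext j k
    rw [Finset.sum_pair (Nat.lt_add_one _).ne]
    simp only [Matrix.of_apply, Nat.sub_self, Nat.add_sub_cancel_left, Pi.add_apply, Pi.smul_apply,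
      smul_eq_mul]
    ring
  rw [alternant, ← Matrix.det_mul_row, hrow]
  refine ((Matrix.detRowAlternating (R := R) (n := Fin l)).toMultilinearMap.map_sum_finset
    (fun j e => b ^ (e - s j) • fun k => z k ^ e) _).trans (Finset.sum_congr rfl fun t _ => ?_)
  rw [MultilinearMap.map_smul_univ, Finset.prod_pow_eq_pow_sum]
  rfl

/-- The strictly increasing exponents `μ'_{l - j} + j`, `0 ≤ j < l`, attached to a diagram `μ` with
at most `l` columns, where `μ'` is the conjugate partition with parts `μ'_1 ≥ μ'_2 ≥ ⋯`. -/
def columnExponents (l : ℕ) (μ : YoungDiagram) (j : Fin l) : ℕ :=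
  μ.colLen j.rev + j

theorem strictMono_columnExponents (μ : YoungDiagram) : StrictMono (columnExponents l μ) := by
  intro i j hij
  have := μ.colLen_anti j.rev i.rev (Fin.rev_le_rev.2 hij.le)
  rw [Fin.lt_def] at hij
  simp only [columnExponents]
  omega

theorem columnExponents_bot : columnExponents l ⊥ = fun j : Fin l => (j : ℕ) := by
  funext j
  simp [columnExponents]

theorem columnExponents_injOn : Set.InjOn (columnExponents l) {μ | μ.rowLen 0 ≤ l} := by
  intro μ hμ ν hν h
  refine ext_colLen fun j => ?_
  by_cases hj : j < l
  · simpa [columnExponents] using congrFun h (Fin.rev ⟨j, hj⟩)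
  · rw [colLen_eq_zero_iff.2 (hμ.trans (not_lt.1 hj)),
      colLen_eq_zero_iff.2 (hν.trans (not_lt.1 hj))]

theorem card_eq_sum_colLen_rev {μ : YoungDiagram} (hμ : μ.rowLen 0 ≤ l) :
    μ.card = ∑ j : Fin l, μ.colLen j.rev := by
  rw [card_eq_sum_colLen hμ, Finset.sum_range]
  exact (Equiv.sum_comp Fin.revPerm fun j : Fin l => μ.colLen j).symm

theorem val_le_of_strictMono {t : Fin l → ℕ} (ht : StrictMono t) (j : Fin l) : (j : ℕ) ≤ t j := by
  obtain ⟨j, hj⟩ := j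
  induction j with
  | zero => exact Nat.zero_le _
  | succ j ih => exact (ih (j.lt_succ_self.trans hj)).trans_lt (ht j.lt_succ_self)

theorem exists_columnExponents_eq {t : Fin l → ℕ} (ht : StrictMono t) :
    ∃ μ : YoungDiagram, μ.rowLen 0 ≤ l ∧ columnExponents l μ = t := by
  let f (j : ℕ) : ℕ := if h : j < l then t (Fin.rev ⟨j, h⟩) - Fin.rev ⟨j, h⟩ else 0
  have hf : Antitone f := by
    refine antitone_nat_of_succ_le fun j => ?_
    by_cases h : j + 1 < l
    · have := ht (Fin.rev_lt_rev.2 (Fin.mk_lt_mk.2 (Nat.lt_succ_self j)) :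
        Fin.rev ⟨j + 1, h⟩ < Fin.rev (⟨j, by omega⟩ : Fin l))
      simp only [f, h, Nat.lt_of_succ_lt h, dif_pos, Fin.val_rev]
      omega
    · simp [f, h]
  obtain ⟨μ, hμ⟩ := exists_colLen_eq hf (N := l) (by simp [f])
  refine ⟨μ, colLen_eq_zero_iff.1 (by simp [hμ, f]), funext fun j => ?_⟩
  have hj : μ.colLen j.rev = t j - j := by
    rw [hμ]
    simp only [f, Fin.is_lt, dif_pos, Fin.eta, Fin.rev_rev]
  rw [columnExponents, hj, Nat.sub_add_cancel (val_le_of_strictMono ht j)]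

/-- The Young diagrams with at most `l` columns obtained from `μ` by adding a horizontal strip. -/
noncomputable def addStrips (l : ℕ) (μ : YoungDiagram) : Finset YoungDiagram :=
  ((finite_setOf_colLen_zero_le_rowLen_zero_le (μ.colLen 0 + 1) l).subset
    fun _ hν => ⟨(isHorizontalStrip_iff_colLen.1 hν.1 0).2, hν.2⟩ :
      {ν | IsHorizontalStrip μ ν ∧ ν.rowLen 0 ≤ l}.Finite).toFinset

@[simp] theorem mem_addStrips {μ ν : YoungDiagram} :
    ν ∈ addStrips l μ ↔ IsHorizontalStrip μ ν ∧ ν.rowLen 0 ≤ l := by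
  simp [addStrips]

theorem isHorizontalStrip_iff_columnExponents {μ ν : YoungDiagram} (hμ : μ.rowLen 0 ≤ l)
    (hν : ν.rowLen 0 ≤ l) : IsHorizontalStrip μ ν ↔ columnExponents l ν ∈
      Fintype.piFinset fun j => {columnExponents l μ j, columnExponents l μ j + 1} := by
  simp only [isHorizontalStrip_iff_colLen, Fintype.mem_piFinset, Finset.mem_insert,
    Finset.mem_singleton, columnExponents]
  constructor
  · intro h j
    have := h j.rev
    omega
  · intro h j
    by_cases hj : j < l
    · have := h (Fin.rev ⟨j, hj⟩)
      rw [Fin.rev_rev] at this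
      simp only at this
      omega
    · rw [colLen_eq_zero_iff.2 (hμ.trans (not_lt.1 hj)),
        colLen_eq_zero_iff.2 (hν.trans (not_lt.1 hj))]
      simp

theorem monotone_of_mem_piFinset_pair {s t : Fin l → ℕ} (hs : StrictMono s)
    (ht : t ∈ Fintype.piFinset fun j => {s j, s j + 1}) : Monotone t := by
  intro i j hij
  rcases hij.eq_or_lt with rfl | hlt
  · exact le_rfl
  · have hi := Fintype.mem_piFinset.1 ht i
    have hj := Fintype.mem_piFinset.1 ht j
    have := hs hlt
    simp only [Finset.mem_insert, Finset.mem_singleton] at hi hj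
    omega

theorem prod_one_add_mul_mul_alternant_columnExponents (b : R) (z : Fin l → R)
    {μ : YoungDiagram} (hμ : μ.rowLen 0 ≤ l) :
    (∏ k, (1 + b * z k)) * alternant (columnExponents l μ) z =
      ∑ ν ∈ addStrips l μ, b ^ (ν.card - μ.card) * alternant (columnExponents l ν) z := by
  rw [prod_one_add_mul_mul_alternant]
  symm
  refine Finset.sum_of_injOn (columnExponents l) ?_ ?_ ?_ ?_
  · exact columnExponents_injOn.mono fun ν hν => (mem_addStrips.1 hν).2
  · intro ν hν
    obtain ⟨hstrip, hrow⟩ := mem_addStrips.1 hν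
    exact (isHorizontalStrip_iff_columnExponents hμ hrow).1 hstrip
  · intro t ht hnot
    rw [alternant_eq_zero_of_not_injective, mul_zero]
    intro hinj
    have hmono := monotone_of_mem_piFinset_pair (strictMono_columnExponents μ) ht
    obtain ⟨ν, hrow, rfl⟩ := exists_columnExponents_eq (hmono.strictMono_of_injective hinj)
    exact hnot ⟨ν, mem_addStrips.2
      ⟨(isHorizontalStrip_iff_columnExponents hμ hrow).2 ht, hrow⟩, rfl⟩
  · intro ν hν
    obtain ⟨hstrip, hrow⟩ := mem_addStrips.1 hν
    rw [card_eq_sum_colLen_rev hμ, card_eq_sum_colLen_rev hrow, ← Finset.sum_tsub_distrib _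
      fun j _ => (isHorizontalStrip_iff_colLen.1 hstrip _).1]
    simp only [columnExponents, Nat.add_sub_add_right]

theorem prod_one_add_mul_mul_vandermonde {n : ℕ} (b : Fin n → R) (z : Fin l → R) :
    (∏ i, ∏ k, (1 + b i * z k)) * ∏ j, ∏ k ∈ Finset.Ioi j, (z k - z j) =
      ∑ μ ∈ boxDiagrams n l, schur b μ * alternant (columnExponents l μ) z := by
  induction n with
  | zero =>
    rw [Finset.sum_eq_single ⊥ (fun μ _ hμ => by rw [schur_zero_of_ne_bot _ hμ, zero_mul])
      (by simp), schur_zero_bot, columnExponents_bot, alternant_val, Fin.prod_univ_zero]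
  | succ n ih =>
    have hswap (μ ν : YoungDiagram) : μ ∈ boxDiagrams n l ∧ ν ∈ addStrips l μ ↔
        μ ∈ (removeStrips ν).filter (fun μ => μ.colLen 0 ≤ n) ∧ ν ∈ boxDiagrams (n + 1) l := by
      simp only [mem_boxDiagrams, mem_addStrips, mem_removeStrips, Finset.mem_filter]
      constructor
      · rintro ⟨⟨hcol, -⟩, hstrip, hrow⟩
        have := isHorizontalStrip_iff_colLen.1 hstrip 0
        exact ⟨⟨hstrip, hcol⟩, by omega, hrow⟩
      · rintro ⟨⟨hstrip, hcol⟩, -, hrow⟩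
        exact ⟨⟨hcol, (le_iff_rowLen.1 hstrip.1 0).trans hrow⟩, hstrip, hrow⟩
    calc (∏ i, ∏ k, (1 + b i * z k)) * ∏ j, ∏ k ∈ Finset.Ioi j, (z k - z j)
        = (∑ μ ∈ boxDiagrams n l, schur (Fin.init b) μ * alternant (columnExponents l μ) z) *
            ∏ k, (1 + b (Fin.last n) * z k) := by
          rw [← ih, Fin.prod_univ_castSucc, mul_right_comm]
          rfl
      _ = ∑ μ ∈ boxDiagrams n l, ∑ ν ∈ addStrips l μ, schur (Fin.init b) μ *
            b (Fin.last n) ^ (ν.card - μ.card) * alternant (columnExponents l ν) z := by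
          rw [Finset.sum_mul]
          refine Finset.sum_congr rfl fun μ hμ => ?_
          rw [mul_assoc, mul_comm (alternant _ _),
            prod_one_add_mul_mul_alternant_columnExponents _ _ (mem_boxDiagrams.1 hμ).2,
            Finset.mul_sum]
          simp only [mul_assoc]
      _ = ∑ ν ∈ boxDiagrams (n + 1) l, ∑ μ ∈ removeStrips ν with μ.colLen 0 ≤ n,
            schur (Fin.init b) μ * b (Fin.last n) ^ (ν.card - μ.card) *
              alternant (columnExponents l ν) z :=
          Finset.sum_comm' hswap
      _ = ∑ ν ∈ boxDiagrams (n + 1) l, schur b ν * alternant (columnExponents l ν) z := by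
          refine Finset.sum_congr rfl fun ν _ => ?_
          rw [schur_succ, Finset.sum_mul]
          refine Finset.sum_filter_of_ne fun μ _ hne => ?_
          contrapose! hne
          rw [schur_eq_zero_of_lt_colLen_zero _ hne, zero_mul, zero_mul]

end Alternants

/-! ### Orthogonality of alternants and the average over the unitary group -/

section UnitaryAverage

open MeasureTheory

theorem sum_perm_sign_mul_prod_comp {R ι : Type*} [CommRing R] [Fintype ι] [DecidableEq ι]
    (M : Matrix ι ι R) (σ : Equiv.Perm ι) :
    ∑ τ : Equiv.Perm ι, ((Equiv.Perm.sign σ : ℤ) : R) * ((Equiv.Perm.sign τ : ℤ) : R) *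
      ∏ k, M (σ k) (τ k) = M.det := by
  have hσ : ((Equiv.Perm.sign σ : ℤ) : R) * ((Equiv.Perm.sign σ : ℤ) : R) = 1 := by
    rw [← Int.cast_mul, ← Units.val_mul, Int.units_mul_self, Units.val_one, Int.cast_one]
  simp only [mul_assoc, ← Finset.mul_sum]
  calc ((Equiv.Perm.sign σ : ℤ) : R) *
        ∑ τ : Equiv.Perm ι, ((Equiv.Perm.sign τ : ℤ) : R) * ∏ k, M (σ k) (τ k)
      = ((Equiv.Perm.sign σ : ℤ) : R) * (M.submatrix σ id).det := by
        rw [← Matrix.det_transpose, Matrix.det_apply']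
        rfl
    _ = M.det := by rw [Matrix.det_permute, ← mul_assoc, hσ, one_mul]

theorem integral_det_mul_det {α ι 𝕜 : Type*} [MeasurableSpace α] [Fintype ι] [DecidableEq ι]
    [RCLike 𝕜] (μ : Measure α) [SigmaFinite μ] {f g : ι → α → 𝕜}
    (hfg : ∀ i j, Integrable (fun x => f i x * g j x) μ) :
    ∫ x : ι → α, (Matrix.of fun i k => f i (x k)).det * (Matrix.of fun j k => g j (x k)).det
        ∂Measure.pi (fun _ => μ) =
      (Fintype.card ι).factorial * (Matrix.of fun i j => ∫ x, f i x * g j x ∂μ).det := by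
  have hint (σ τ : Equiv.Perm ι) : Integrable (fun x : ι → α =>
      ((Equiv.Perm.sign σ : ℤ) : 𝕜) * ((Equiv.Perm.sign τ : ℤ) : 𝕜) *
        ∏ k, f (σ k) (x k) * g (τ k) (x k)) (Measure.pi fun _ => μ) :=
    (Integrable.fintype_prod fun k => hfg (σ k) (τ k)).const_mul _
  calc ∫ x : ι → α, (Matrix.of fun i k => f i (x k)).det * (Matrix.of fun j k => g j (x k)).det
        ∂Measure.pi (fun _ => μ)
      = ∫ x : ι → α, ∑ σ : Equiv.Perm ι, ∑ τ : Equiv.Perm ι,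
          ((Equiv.Perm.sign σ : ℤ) : 𝕜) * ((Equiv.Perm.sign τ : ℤ) : 𝕜) *
            ∏ k, f (σ k) (x k) * g (τ k) (x k) ∂Measure.pi (fun _ => μ) := by
        simp only [Matrix.det_apply', Matrix.of_apply, Finset.sum_mul_sum,
          Finset.prod_mul_distrib, mul_mul_mul_comm]
    _ = ∑ σ : Equiv.Perm ι, ∑ τ : Equiv.Perm ι,
          ((Equiv.Perm.sign σ : ℤ) : 𝕜) * ((Equiv.Perm.sign τ : ℤ) : 𝕜) *
            ∏ k, ∫ x, f (σ k) x * g (τ k) x ∂μ := by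
        rw [integral_finsetSum _ fun σ _ => integrable_finsetSum _ fun τ _ => hint σ τ]
        refine Finset.sum_congr rfl fun σ _ => ?_
        rw [integral_finsetSum _ fun τ _ => hint σ τ]
        refine Finset.sum_congr rfl fun τ _ => ?_
        rw [integral_const_mul, integral_fintype_prod_eq_prod fun k x => f (σ k) x * g (τ k) x]
    _ = (Fintype.card ι).factorial * (Matrix.of fun i j => ∫ x, f i x * g j x ∂μ).det := by
        refine (Finset.sum_congr rfl fun σ _ => sum_perm_sign_mul_prod_comp
          (Matrix.of fun i j => ∫ x, f i x * g j x ∂μ) σ).trans ?_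
        rw [Finset.sum_const, Finset.card_univ, Fintype.card_perm, nsmul_eq_mul]

theorem det_of_ite_eq {R : Type*} [CommRing R] {l : ℕ} {s t : Fin l → ℕ} (hs : StrictMono s)
    (ht : StrictMono t) (c : R) :
    (Matrix.of fun i j => if s i = t j then c else 0).det = if s = t then c ^ l else 0 := by
  split_ifs with hst
  · subst hst
    simp only [hs.injective.eq_iff]
    exact (Matrix.det_diagonal (d := fun _ => c)).trans (by simp)
  · obtain ⟨i, hi⟩ : ∃ i, s i ∉ Set.range t := by
      by_contra! h
      refine hst ((hs.range_inj ht).1 (Set.eq_of_subset_of_ncard_le (Set.range_subset_iff.2 h) ?_))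
      rw [Set.ncard_range_of_injective hs.injective, Set.ncard_range_of_injective ht.injective]
    exact Matrix.det_eq_zero_of_row_eq_zero i fun j => if_neg fun h => hi ⟨j, h.symm⟩

theorem integral_exp_neg_pow_mul_exp_pow (m n : ℕ) :
    ∫ θ in Set.Icc 0 (2 * Real.pi),
      Complex.exp (-(Complex.I * (θ : ℂ))) ^ m * Complex.exp (Complex.I * (θ : ℂ)) ^ n =
      if m = n then (2 * Real.pi : ℂ) else 0 := by
  have hexp (θ : ℝ) : Complex.exp (-(Complex.I * (θ : ℂ))) ^ m *
      Complex.exp (Complex.I * (θ : ℂ)) ^ n = Complex.exp ((((n : ℂ) - m) * Complex.I) * θ) := by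
    rw [← Complex.exp_nat_mul, ← Complex.exp_nat_mul, ← Complex.exp_add]
    ring_nf
  simp only [hexp]
  rw [integral_Icc_eq_integral_Ioc, ← intervalIntegral.integral_of_le (by positivity)]
  split_ifs with h
  · subst h
    simp
  · have hc : ((n : ℂ) - m) * Complex.I ≠ 0 :=
      mul_ne_zero (sub_ne_zero.2 (Nat.cast_injective.ne (Ne.symm h))) Complex.I_ne_zero
    have hperiod : Complex.exp (((n : ℂ) - m) * Complex.I * ((2 * Real.pi : ℝ) : ℂ)) = 1 := by
      refine Complex.exp_eq_one_iff.2 ⟨(n : ℤ) - m, ?_⟩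
      push_cast
      ring
    rw [integral_exp_mul_complex hc, hperiod]
    simp

theorem volume_restrict_Icc_eq_pi {ι : Type*} [Fintype ι] (a b : ι → ℝ) :
    (volume : Measure (ι → ℝ)).restrict (Set.Icc a b) =
      Measure.pi fun i => volume.restrict (Set.Icc (a i) (b i)) := by
  rw [← Set.pi_univ_Icc, volume_pi, Measure.restrict_pi_pi]

theorem integral_alternant_mul_alternant {l : ℕ} {s t : Fin l → ℕ} (hs : StrictMono s)
    (ht : StrictMono t) :
    ∫ θ in Set.Icc (0 : Fin l → ℝ) (fun _ => 2 * Real.pi),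
      alternant s (fun k => Complex.exp (-(Complex.I * (θ k : ℂ)))) *
        alternant t (fun k => Complex.exp (Complex.I * (θ k : ℂ))) =
      if s = t then (2 * Real.pi : ℂ) ^ l * (Nat.factorial l : ℂ) else 0 := by
  rw [volume_restrict_Icc_eq_pi]
  refine (integral_det_mul_det (ι := Fin l) (volume.restrict (Set.Icc 0 (2 * Real.pi)))
    (f := fun i θ => Complex.exp (-(Complex.I * (θ : ℂ))) ^ s i)
    (g := fun j θ => Complex.exp (Complex.I * (θ : ℂ)) ^ t j)
    fun i j => ContinuousOn.integrableOn_compact isCompact_Icc (by fun_prop)).trans ?_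
  simp only [integral_exp_neg_pow_mul_exp_pow, det_of_ite_eq hs ht, Fintype.card_fin,
    mul_comm (Nat.factorial l : ℂ), ite_mul, zero_mul]

theorem ofReal_unitaryDensity (l : ℕ) (θ : Fin l → ℝ) :
    (unitaryDensity l θ : ℂ) = ((2 * Real.pi : ℂ) ^ l * (Nat.factorial l : ℂ))⁻¹ *
      ((∏ j : Fin l, ∏ k ∈ Finset.Ioi j,
        (Complex.exp (-(Complex.I * (θ k : ℂ))) - Complex.exp (-(Complex.I * (θ j : ℂ))))) *
      ∏ j : Fin l, ∏ k ∈ Finset.Ioi j,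
        (Complex.exp (Complex.I * (θ k : ℂ)) - Complex.exp (Complex.I * (θ j : ℂ)))) := by
  have hconj (t : ℝ) : Complex.exp (-(Complex.I * (t : ℂ))) =
      (starRingEnd ℂ) (Complex.exp (Complex.I * (t : ℂ))) := by
    rw [← Complex.exp_conj]
    simp
  simp only [unitaryDensity, ← Finset.prod_mul_distrib, hconj, ← map_sub, Complex.conj_mul']
  push_cast
  rw [one_div]

theorem prod_mul_unitaryDensity {n : ℕ} (a b : Fin n → ℂ) (l : ℕ) (θ : Fin l → ℝ) :
    (∏ j : Fin n, ∏ k : Fin l,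
      (1 + a j * Complex.exp (-(Complex.I * (θ k : ℂ)))) *
        (1 + b j * Complex.exp (Complex.I * (θ k : ℂ)))) * (unitaryDensity l θ : ℂ) =
      ((2 * Real.pi : ℂ) ^ l * (Nat.factorial l : ℂ))⁻¹ *
        ∑ μ ∈ boxDiagrams n l, ∑ ν ∈ boxDiagrams n l, schur a μ * schur b ν *
          (alternant (columnExponents l μ) (fun k => Complex.exp (-(Complex.I * (θ k : ℂ)))) *
            alternant (columnExponents l ν) (fun k => Complex.exp (Complex.I * (θ k : ℂ)))) := by
  simp only [ofReal_unitaryDensity, Finset.prod_mul_distrib]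
  rw [mul_left_comm, mul_mul_mul_comm, prod_one_add_mul_mul_vandermonde a,
    prod_one_add_mul_mul_vandermonde b, Finset.sum_mul_sum]
  simp only [mul_mul_mul_comm]

theorem integrableOn_alternant_mul_alternant {l : ℕ} (s t : Fin l → ℕ) :
    IntegrableOn (fun θ : Fin l → ℝ =>
      alternant s (fun k => Complex.exp (-(Complex.I * (θ k : ℂ)))) *
        alternant t (fun k => Complex.exp (Complex.I * (θ k : ℂ))))
      (Set.Icc 0 fun _ => 2 * Real.pi) := by
  refine ContinuousOn.integrableOn_compact isCompact_Icc ?_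
  simp only [alternant, Matrix.det_apply', Matrix.of_apply]
  fun_prop

theorem unitaryAverage_prod_eq_sum_schur_mul_schur {n : ℕ} (a b : Fin n → ℂ) (l : ℕ) :
    unitaryAverage l (fun θ => ∏ j : Fin n, ∏ k : Fin l,
      (1 + a j * Complex.exp (-(Complex.I * (θ k : ℂ)))) *
        (1 + b j * Complex.exp (Complex.I * (θ k : ℂ)))) =
      ∑ μ ∈ boxDiagrams n l, schur a μ * schur b μ := by
  have hint (μ ν : YoungDiagram) := (integrableOn_alternant_mul_alternant
    (columnExponents l μ) (columnExponents l ν)).const_mul (schur a μ * schur b ν)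
  have hne : (2 * Real.pi : ℂ) ^ l * (Nat.factorial l : ℂ) ≠ 0 := by
    have := Real.pi_ne_zero
    have := Nat.factorial_ne_zero l
    simp_all
  simp only [unitaryAverage, prod_mul_unitaryDensity]
  rw [integral_const_mul, inv_mul_eq_iff_eq_mul₀ hne,
    integral_finsetSum _ fun μ _ => integrable_finsetSum _ fun ν _ => hint μ ν, Finset.mul_sum]
  refine Finset.sum_congr rfl fun μ hμ => ?_
  rw [integral_finsetSum _ fun ν _ => hint μ ν, Finset.sum_eq_single_of_mem μ hμ]
  · rw [integral_const_mul, integral_alternant_mul_alternant (strictMono_columnExponents _)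
      (strictMono_columnExponents _), if_pos rfl, mul_comm]
  · intro ν hν hne
    rw [integral_const_mul, integral_alternant_mul_alternant (strictMono_columnExponents _)
      (strictMono_columnExponents _), if_neg, mul_zero]
    exact fun h => hne (columnExponents_injOn (mem_boxDiagrams.1 hν).2 (mem_boxDiagrams.1 hμ).2
      h.symm)

end UnitaryAverage
/-! ### The distribution of the last passage time -/

section Probability

open MeasureTheory ProbabilityTheory

variable {Ω : Type*} [MeasurableSpace Ω] {P : Measure Ω}

theorem measureReal_mem_finset_eq_sum_prod {ι : Type*} [Fintype ι] {β : ι → Type*}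
    [∀ i, MeasurableSpace (β i)] [∀ i, MeasurableSingletonClass (β i)] {X : ∀ i, Ω → β i}
    (hX : ∀ i, AEMeasurable (X i) P) (hindep : iIndepFun X P) (S : Finset (∀ i, β i)) :
    P.real {ω | (fun i => X i ω) ∈ S} = ∑ x ∈ S, ∏ i, P.real {ω | X i ω = x i} := by
  have := hindep.isProbabilityMeasure
  have hmap := (iIndepFun_iff_map_fun_eq_pi_map hX).1 hindep
  have (i : ι) := Measure.isProbabilityMeasure_map (hX i)
  calc P.real {ω | (fun i => X i ω) ∈ S}
      = (P.map fun ω i => X i ω).real S :=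
        (map_measureReal_apply_of_aemeasurable (aemeasurable_pi_lambda _ hX) S.measurableSet).symm
    _ = ∑ x ∈ S, (Measure.pi fun i => P.map (X i)).real {x} := by
        rw [hmap, sum_measureReal_singleton]
    _ = ∑ x ∈ S, ∏ i, (P.map (X i)).real {x i} := by
        simp only [measureReal_def, Measure.pi_singleton, ENNReal.toReal_prod]
    _ = ∑ x ∈ S, ∏ i, P.real {ω | X i ω = x i} := by
        simp only [map_measureReal_apply_of_aemeasurable (hX _) (measurableSet_singleton _)]
        rfl

theorem measureReal_mem_finset_of_geometric {ι κ : Type*} [Fintype ι] [Fintype κ] {a : ι → ℝ}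
    {b : κ → ℝ} {X : ι → κ → Ω → ℕ} (hX : ∀ i j, AEMeasurable (X i j) P)
    (hindep : iIndepFun (fun s : ι × κ => X s.1 s.2) P)
    (hgeom : ∀ i j k, P.real {ω | X i j ω = k} = (1 - a i * b j) * (a i * b j) ^ k)
    (S : Finset (ι → κ → ℕ)) :
    P.real {ω | (fun i j => X i j ω) ∈ S} =
      (∏ i, ∏ j, (1 - a i * b j)) * ∑ x ∈ S, ∏ i, ∏ j, (a i * b j) ^ x i j := by
  have hevent : {ω | (fun i j => X i j ω) ∈ S} =
      {ω | (fun s : ι × κ => X s.1 s.2 ω) ∈ S.map (Equiv.curry ι κ ℕ).symm.toEmbedding} := by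
    ext ω
    rw [Set.mem_ofPred_eq, Set.mem_ofPred_eq, Finset.mem_map_equiv]
    rfl
  rw [hevent, measureReal_mem_finset_eq_sum_prod (X := fun s : ι × κ => X s.1 s.2)
    (fun s => hX s.1 s.2) hindep, Finset.sum_map, Finset.mul_sum]
  refine Finset.sum_congr rfl fun x _ => ?_
  simp [hgeom, Fintype.prod_prod_type, Finset.prod_mul_distrib]

end Probability

end JohanssonModel

theorem mainTheorem6 {Ω : Type*} [MeasurableSpace Ω]
    (P : MeasureTheory.Measure Ω) [MeasureTheory.IsProbabilityMeasure P]
    (n : ℕ) [NeZero n] (a b : Fin n → ℝ)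
    (hab : ∀ i j, 0 ≤ a i * b j ∧ a i * b j < 1)
    (X : Fin n → Fin n → Ω → ℕ)
    (hmeas : ∀ i j, Measurable (X i j))
    (hindep : ProbabilityTheory.iIndepFun (fun s : Fin n × Fin n => X s.1 s.2) P)
    (hgeom : ∀ i j k, P.real {ω | X i j ω = k} = (1 - a i * b j) * (a i * b j) ^ k)
    (l : ℕ) :
    ((P.real {ω | JohanssonModel.lastPassageTime (fun i j => X i j ω) ≤ l} : ℝ) : ℂ) =
      (∏ i : Fin n, ∏ j : Fin n, (1 - (a i : ℂ) * (b j : ℂ))) *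
        JohanssonModel.unitaryAverage l (fun θ =>
          ∏ j : Fin n, ∏ k : Fin l,
            (1 + (a j : ℂ) * Complex.exp (-(Complex.I * (θ k : ℂ)))) *
              (1 + (b j : ℂ) * Complex.exp (Complex.I * (θ k : ℂ)))) := by
  open JohanssonModel in
  have hevent : {ω | lastPassageTime (fun i j => X i j ω) ≤ l} =
      {ω | (fun i j => X i j ω) ∈ (finite_setOf_rowLen_zero_shape_le n n l).toFinset} := by
    simp only [lastPassageTime_eq_rowLen_zero_shape, Set.Finite.mem_toFinset, Set.mem_ofPred_eq]
  rw [hevent, measureReal_mem_finset_of_geometric (fun i j => (hmeas i j).aemeasurable) hindep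
      hgeom,
    unitaryAverage_prod_eq_sum_schur_mul_schur, ← sum_prod_mul_pow_eq_sum_schur_mul_schur]
  push_cast
  rfl
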